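/- Let $k$ be a field containing all roots of unity (every polynomial $X^m-1$, $m\ge 1$, splits over $k$), and let $n\ge 0$. Call a positive integer $s$ admissible if $s$ is invertible in $k$, and let $\Lambda\subseteq\mathbb{Q}$ be the group of rational numbers with admissible denominator (so $\Lambda=\mathbb{Q}$ in characteristic $0$ and $\Lambda=\mathbb{Z}_{(p)}$ in characteristic $p$). Put $$\mathbb{E}_n=\bigcup_{s\ \text{admissible}}k[t_1^{\pm1/s},\dots,t_n^{\pm1/s}],\qquad \Gamma_n=\Bigl(\varprojlim_{s\ \text{admissible}}\mathbb{Z}/s\Bigr)^n ,$$ so that $\Gamma_n=\hat{\mathbb{Z}}^n$ in characteristic $0$ and $\Gamma_n=\bigl(\prod_{q\ne p}\mathbb{Z}_q\bigr)^n$ in characteristic $p$, with its profinite topology. Fix an isomorphism $\theta:\Lambda/\mathbb{Z}\to\mu_\infty(k)$ onto the group of all roots of unity of $k$. Let $\gamma=(\gamma_1,\dots,\gamma_n)\in\Gamma_n$ act on $\mathbb{E}_n$ by the $k$-algebra automorphism with $t_i^{1/m}\mapsto\theta(1/m)^{\gamma_i \bmod m}\,t_i^{1/m}$, let the symmetric group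 $\Sigma_n$ act on $\mathbb{E}_n$ by permuting the variables and on $\Gamma_n$ by permuting the factors, and consider the resulting action of $\Sigma_n\ltimes\Gamma_n$ on $\mathbb{E}_n$, where $\Sigma_n\ltimes\Gamma_n$ carries the product topology with $\Sigma_n$ discrete. Let $G$ be a closed subgroup of $\Sigma_n\ltimes\Gamma_n$ that is torsion free (its only element of finite order is the identity). Then $\mathbb{E}_n^G\subseteq\mathbb{E}_n$ is an (infinite) Galois extension of commutative rings with Galois group $G$. That is, writing $R=\mathbb{E}_n^G$ and $S=\mathbb{E}_n$: 1. $S$ is connected (it is nonzero and its only idempotents are $0$ and $1$), every finite subset of $S$ is contained in an $R$-subalgebra $T\subseteq S$ that is strongly separable (finitely generated and projective as an $R$-module, and projective as a $T\otimes_R T$-module via the multiplication map), and every element of $S$ fixed by all $R$-algebra automorphisms of $S$ lies in $R$; 2. the action of $G$ induces an isomorphism of groups $G\to\mathrm{Aut}_R(S)$. -/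

import Mathlib

open scoped TensorProduct

namespace TorusGalois

noncomputable section

/-! ### Galois ring extensions -/

/-- A commutative `R`-algebra `S` is separable if `S` is projective as a module over `S ⊗[R] S`,
the module structure being given by the multiplication map `S ⊗[R] S → S`. -/
def IsSeparableAlg (R S : Type*) [CommRing R] [CommRing S] [Algebra R S] : Prop :=
  letI : Module (S ⊗[R] S) S := Module.compHom S (Algebra.TensorProduct.lmul' R (S := S)).toRingHom
  Module.Projective (S ⊗[R] S) S

/-- A strongly separable algebra: separable, and finitely generated projective as a module. -/
structure IsStronglySeparable (R S : Type*) [CommRing R] [CommRing S] [Algebra R S] : Prop where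
  separable : IsSeparableAlg R S
  finite : Module.Finite R S
  projective : Module.Projective R S

/-- Infinite Galois extensions `R ⊆ S` of commutative rings: `S` is connected, every finite subset
of `S` lies in a strongly separable `R`-subalgebra, and the elements of `S` that are fixed by all
`R`-algebra automorphisms of `S` are exactly those of `R`. -/
structure IsGaloisExtension (R S : Type*) [CommRing R] [CommRing S] [Algebra R S] : Prop where
  injective : Function.Injective (algebraMap R S)
  nontrivial : Nontrivial S
  connected : ∀ e : S, e * e = e → e = 0 ∨ e = 1
  locallyStronglySeparable :
    ∀ F : Finset S, ∃ T : Subalgebra R S, (F : Set S) ⊆ T ∧ IsStronglySeparable R T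
  fixed : ∀ x : S, (∀ f : S ≃ₐ[R] S, f x = x) → x ∈ Set.range (algebraMap R S)

/-! ### The rings and groups -/

variable (k : Type*) [Field k]

/-- The rational numbers whose denominator is invertible in `k`: all of `ℚ` in characteristic zero,
and the localization of `ℤ` at the prime `p` in characteristic `p`. -/
def Expo : AddSubgroup ℚ where
  carrier := {q | (q.den : k) ≠ 0}
  zero_mem' := by simp
  add_mem' {a b} ha hb := by
    obtain ⟨c, hc⟩ := Rat.add_den_dvd a b
    have h : ((a.den * b.den : ℕ) : k) ≠ 0 := by
      push_cast; exact mul_ne_zero ha hb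
    rw [hc] at h
    push_cast at h
    exact left_ne_zero_of_mul h
  neg_mem' {a} ha := by simpa using ha

/-- The subgroup `ℤ` of `Expo k`. -/
def intExpo : AddSubgroup (Expo k) :=
  AddSubgroup.zmultiples ⟨1, by simp [Expo]⟩

/-- The ring `𝔼_n`, the union over `s` (invertible in `k`) of the Laurent polynomial rings
`k[t_1^{±1/s}, …, t_n^{±1/s}]`: it has the monomials `t^a = t_1^{a_1} ⋯ t_n^{a_n}`, with `a_i` in
`Expo k`, as a `k`-basis, and `t^a * t^b = t^(a + b)`. -/
abbrev EE (n : ℕ) : Type _ := AddMonoidAlgebra k (Fin n → Expo k)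

/-- The inverse limit of the rings `ℤ/s` over all positive integers `s` that are invertible in `k`,
ordered by divisibility, as an additive group with the profinite topology: `ℤ̂` in characteristic
zero, and the product of the groups `ℤ_q` over the primes `q ≠ p` in characteristic `p`. -/
def ZHat : AddSubgroup (∀ s : {s : ℕ // (s : k) ≠ 0}, ZMod s.1) where
  carrier := {x | ∀ (s t : {s : ℕ // (s : k) ≠ 0}) (h : s.1 ∣ t.1),
    ZMod.castHom h (ZMod s.1) (x t) = x s}
  zero_mem' := by intro s t h; simp
  add_mem' {a b} ha hb := by
    intro s t h
    rw [Pi.add_apply, Pi.add_apply, map_add, ha s t h, hb s t h]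
  neg_mem' {a} ha := by
    intro s t h
    rw [Pi.neg_apply, Pi.neg_apply, map_neg, ha s t h]

/-- The group `Γ_n`, with the product topology, written multiplicatively. -/
abbrev Gam (n : ℕ) : Type _ := Fin n → Multiplicative (ZHat k)

/-- The group `Σ_n ⋉ Γ_n`, where `Σ_n` permutes the factors: `(σ x)_i = x_{σ⁻¹ i}`. -/
abbrev SigmaGam (n : ℕ) : Type _ :=
  Gam k n ⋊[(mulAutArrow : Equiv.Perm (Fin n) →* MulAut (Gam k n))] Equiv.Perm (Fin n)

/-- The product topology of `Γ_n` and the discrete group `Σ_n`. -/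
instance sigmaGamTopology (n : ℕ) : TopologicalSpace (SigmaGam k n) :=
  TopologicalSpace.induced (fun g ↦ g.left) (Pi.topologicalSpace : TopologicalSpace (Gam k n)) ⊓
    TopologicalSpace.induced (fun g ↦ g.right) ⊥

/-- The group `μ_∞` of all roots of unity in `k`. -/
abbrev MuInf : Type _ := CommGroup.torsion kˣ

/-! ### The action -/

variable {k}

/-- The product `x • q` in `Expo k / ℤ`, for `x` in `ZHat k` and `q` in `Expo k`: if `q = a / m`,
then `x` acts as multiplication by any integer congruent to `x` modulo `m`. -/
def pair (x : ZHat k) (q : Expo k) : Expo k ⧸ intExpo k :=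
  QuotientAddGroup.mk ((x.1 ⟨q.1.den, q.2⟩).val • q)

theorem nsmul_mk_eq_zero {m : ℕ} (q : Expo k) (h : q.1.den ∣ m) :
    m • (QuotientAddGroup.mk q : Expo k ⧸ intExpo k) = 0 := by
  obtain ⟨c, rfl⟩ := h
  rw [← QuotientAddGroup.mk_nsmul, QuotientAddGroup.eq_zero_iff, intExpo,
    AddSubgroup.mem_zmultiples_iff]
  refine ⟨c * q.1.num, Subtype.ext ?_⟩
  have h1 : (q.1.den : ℚ) * q.1 = q.1.num := Rat.den_mul_eq_num q.1
  simp only [AddSubgroup.coe_zsmul, AddSubgroup.coe_nsmul, zsmul_eq_mul, nsmul_eq_mul]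
  push_cast
  linear_combination (-(c : ℚ)) * h1

theorem nsmul_mk_eq {m a b : ℕ} (q : Expo k) (h : q.1.den ∣ m) (hab : a ≡ b [MOD m]) :
    a • (QuotientAddGroup.mk q : Expo k ⧸ intExpo k) = b • QuotientAddGroup.mk q := by
  have key : ∀ c : ℕ, c • (QuotientAddGroup.mk q : Expo k ⧸ intExpo k) =
      (c % m) • QuotientAddGroup.mk q := by
    intro c
    conv_lhs => rw [← Nat.div_add_mod c m]
    rw [add_nsmul, mul_comm, mul_nsmul', nsmul_mk_eq_zero q h, nsmul_zero, zero_add]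
  rw [key a, key b, hab]

theorem pair_eq (x : ZHat k) (q : Expo k) (m : {s : ℕ // (s : k) ≠ 0}) (h : q.1.den ∣ m.1) :
    pair x q = (x.1 m).val • QuotientAddGroup.mk q := by
  rw [pair, QuotientAddGroup.mk_nsmul]
  refine nsmul_mk_eq q dvd_rfl ?_
  have hm : m.1 ≠ 0 := fun h0 ↦ m.2 (by simp [h0])
  have : NeZero m.1 := ⟨hm⟩
  have : NeZero q.1.den := ⟨q.1.den_nz⟩
  rw [← x.2 ⟨q.1.den, q.2⟩ m h, ZMod.castHom_apply, ZMod.cast_eq_val, ZMod.val_natCast]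
  exact Nat.mod_modEq _ _

theorem pair_add_right (x : ZHat k) (q r : Expo k) : pair x (q + r) = pair x q + pair x r := by
  let m : {s : ℕ // (s : k) ≠ 0} :=
    ⟨q.1.den * r.1.den, by push_cast; exact mul_ne_zero q.2 r.2⟩
  rw [pair_eq x (q + r) m (Rat.add_den_dvd q.1 r.1), pair_eq x q m (Dvd.intro _ rfl),
    pair_eq x r m (Dvd.intro_left _ rfl), QuotientAddGroup.mk_add, nsmul_add]

theorem pair_add_left (x y : ZHat k) (q : Expo k) : pair (x + y) q = pair x q + pair y q := by
  have : NeZero q.1.den := ⟨q.1.den_nz⟩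
  simp only [pair, QuotientAddGroup.mk_nsmul]
  rw [← add_nsmul]
  refine nsmul_mk_eq q dvd_rfl ?_
  change (x.1 ⟨q.1.den, q.2⟩ + y.1 ⟨q.1.den, q.2⟩).val ≡ _ [MOD _]
  rw [ZMod.val_add]
  exact Nat.mod_modEq _ _

theorem pair_zero_right (x : ZHat k) : pair x 0 = 0 := by
  simpa using pair_add_right x 0 0

theorem pair_zero_left (q : Expo k) : pair 0 q = 0 := by
  simpa using pair_add_left 0 0 q

variable (θ : (Expo k ⧸ intExpo k) ≃+ Additive (MuInf k))

/-- The root of unity by which `x` multiplies `t^q` (one variable): `θ(x • q)`. -/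
def chi (x : ZHat k) (q : Expo k) : kˣ := ((θ (pair x q)).toMul : MuInf k)

theorem chi_add_right (x : ZHat k) (q r : Expo k) : chi θ x (q + r) = chi θ x q * chi θ x r := by
  simp [chi, pair_add_right]

theorem chi_add_left (x y : ZHat k) (q : Expo k) : chi θ (x + y) q = chi θ x q * chi θ y q := by
  simp [chi, pair_add_left]

theorem chi_zero_right (x : ZHat k) : chi θ x 0 = 1 := by
  simp [chi, pair_zero_right]

theorem chi_zero_left (q : Expo k) : chi θ 0 q = 1 := by
  simp [chi, pair_zero_left]

/-- The scalar by which `x = (x_1, …, x_n)` in `Γ_n` multiplies the monomial `t^a`. -/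
def scalar {n : ℕ} (x : Gam k n) (a : Fin n → Expo k) : k :=
  ∏ i, (chi θ (x i).toAdd (a i) : k)

/-- The action of an element `g = x σ` of `Σ_n ⋉ Γ_n` on the monomials of `𝔼_n`: first `σ` sends
`t_i` to `t_{σ i}`, hence `t^a` to `t^b` with `b_i = a_{σ⁻¹ i}`, and then `x` multiplies `t^b` by
a root of unity. -/
def monoAct {n : ℕ} (g : SigmaGam k n) : Multiplicative (Fin n → Expo k) →* EE k n where
  toFun a := AddMonoidAlgebra.single (fun i ↦ a.toAdd (g.right⁻¹ i))
    (scalar θ g.left (fun i ↦ a.toAdd (g.right⁻¹ i)))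
  map_one' := by
    simp [scalar, chi_zero_right, AddMonoidAlgebra.one_def]
    rfl
  map_mul' a b := by
    rw [AddMonoidAlgebra.single_mul_single]
    simp only [scalar, toAdd_mul, Pi.add_apply, chi_add_right, Units.val_mul,
      Finset.prod_mul_distrib]
    rfl

/-- The action of `Σ_n ⋉ Γ_n` on `𝔼_n` by `k`-algebra endomorphisms. -/
def actHom (n : ℕ) : SigmaGam k n →* (EE k n →ₐ[k] EE k n) where
  toFun g := AddMonoidAlgebra.lift k (EE k n) (Fin n → Expo k) (monoAct θ g)
  map_one' := by
    refine AddMonoidAlgebra.algHom_ext (fun a ↦ ?_) (by ext)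
    simp [monoAct, scalar, chi_zero_left]
  map_mul' g h := by
    refine AddMonoidAlgebra.algHom_ext (fun a ↦ ?_) (by ext)
    have hs : ∀ (u : Gam k n) (σ : Equiv.Perm (Fin n)) (c : Fin n → Expo k),
        scalar θ (mulAutArrow σ u) (fun i ↦ c (σ⁻¹ i)) = scalar θ u c := by
      intro u σ c
      exact Equiv.prod_comp σ⁻¹ (fun i ↦ (chi θ (u i).toAdd (c i) : k))
    have hm : ∀ (u v : Gam k n) (c : Fin n → Expo k),
        scalar θ (u * v) c = scalar θ u c * scalar θ v c := by
      intro u v c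
      simp [scalar, chi_add_left, Finset.prod_mul_distrib]
    simp only [AddMonoidAlgebra.lift_single, one_smul, AlgHom.mul_apply, monoAct, MonoidHom.coe_mk,
      OneHom.coe_mk, toAdd_ofAdd, SemidirectProduct.mul_left, SemidirectProduct.mul_right,
      mul_inv_rev, Equiv.Perm.mul_apply, hm, AddMonoidAlgebra.smul_single, smul_eq_mul]
    rw [hs h.left g.right (fun i ↦ a (h.right⁻¹ i)), mul_comm]

/-- The action of `Σ_n ⋉ Γ_n` on `𝔼_n` by `k`-algebra automorphisms. -/
def act (n : ℕ) : SigmaGam k n →* (EE k n ≃ₐ[k] EE k n) :=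
  (AlgEquiv.algHomUnitsEquiv k (EE k n)).toMonoidHom.comp (actHom θ n).toHomUnits

/-- The fixed ring `𝔼_n^G` of a subgroup `G` of `Σ_n ⋉ Γ_n`. -/
def fixedRing {n : ℕ} (G : Subgroup (SigmaGam k n)) : Subalgebra k (EE k n) where
  carrier := {f | ∀ g ∈ G, act θ n g f = f}
  mul_mem' ha hb g hg := by rw [map_mul, ha g hg, hb g hg]
  add_mem' ha hb g hg := by rw [map_add, ha g hg, hb g hg]
  algebraMap_mem' r g _ := (act θ n g).commutes r

/-- The action of `G` on `𝔼_n` by `𝔼_n^G`-algebra automorphisms. -/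
def galoisHom {n : ℕ} (G : Subgroup (SigmaGam k n)) :
    G →* (EE k n ≃ₐ[fixedRing θ G] EE k n) where
  toFun g := AlgEquiv.ofRingEquiv (f := (act θ n g).toRingEquiv) fun r ↦ r.2 g g.2
  map_one' := by ext1 f; simp
  map_mul' g h := by
    ext1 f
    change act θ n (g * h : SigmaGam k n) f = act θ n g (act θ n h f)
    rw [map_mul, AlgEquiv.mul_apply]

end

end TorusGalois

/-!
Write `R` for the ring of invariants of `G` in `S = 𝔼_n`. A closed subgroup `G` of `Σ_n ⋉ Γ_n` is
profinite and acts continuously on the discrete ring `S`.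

The action has no inertia: only the identity of `G` acts trivially on `S` modulo a prime `Q`.
If `g` acts trivially modulo `Q`, so does its power `g ^ d` with `d` the order of the permutation
part of `g`. This power lies in `Γ_n`, so it multiplies each monomial by a root of unity in `k`.
Monomials are units, so these roots of unity are `1` modulo `Q`, hence equal to `1`, and
`g ^ d = 1` because `Γ_n` acts faithfully on the monomials. As `G` is torsion free, `g = 1`
(`isOfFinOrder_of_act_sub_mem`).

Everything else holds for any profinite group `G` acting continuously and without inertia on a
discrete commutative ring `S` with ring of invariants `R`.

* For an open normal subgroup `N`, the finite group `G/N` acts without inertia on the fixed ring of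
  `N` (`inertia_quotient_eq_bot`). This uses that `N` permutes transitively the primes of `S` over
  a given prime of its fixed ring, and that decomposition groups surject onto the residual
  automorphism groups.
* A finite group `H` acting without inertia on `T` gives a strongly separable extension of the
  invariants (`isStronglySeparable_of_inertia_eq_bot`): there is `∑ x ⊗ y` in `T ⊗ T` such that
  `∑ x * h y` is `1` for `h = 1` and `0` otherwise. It provides a dual basis with respect to the
  trace form as well as a separability idempotent.
* Every finite subset of `S` is fixed by some open normal subgroup, so it lies in a strongly
  separable subalgebra (`exists_isStronglySeparable_subalgebra`).
* If `S` is a domain, as is `𝔼_n`, then `G` is the decomposition group of the zero ideal, so the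
  surjectivity above says that `G` maps onto the automorphism group of `S` over `R`
  (`exists_smul_eq_algEquiv`). Injectivity is the absence of inertia at the zero ideal.
-/

namespace TorusGalois

/-! ### Finite groups acting without inertia -/

section FiniteGroup

theorem exists_algebraMap_eq_sum_smul {R T H : Type*} [CommRing R] [CommRing T] [Algebra R T]
    [Group H] [MulSemiringAction H T] [Fintype H] [Algebra.IsInvariant R T H] (t : T) :
    ∃ r : R, algebraMap R T r = ∑ h : H, h • t := by
  refine Algebra.IsInvariant.isInvariant (G := H) _ fun g ↦ ?_
  rw [Finset.smul_sum]
  simp_rw [← mul_smul]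
  exact Fintype.sum_equiv (Equiv.mulLeft g) _ _ fun _ ↦ rfl

variable {R T H : Type*} [CommRing R] [CommRing T] [Algebra R T] [Group H]
  [MulSemiringAction H T] [SMulCommClass H R T]

/-- The algebra map `T ⊗[R] T → T`, `a ⊗ b ↦ a * h b`: the component at `h` of the comparison map
from `T ⊗[R] T` to the product of copies of `T` indexed by the group. -/
noncomputable def twistedMul (R T : Type*) {H : Type*} [CommRing R] [CommRing T] [Algebra R T]
    [Group H] [MulSemiringAction H T] [SMulCommClass H R T] (h : H) : T ⊗[R] T →ₐ[R] T :=
  Algebra.TensorProduct.lift (AlgHom.id R T) (MulSemiringAction.toAlgHom R T h)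
    fun _ _ ↦ Commute.all _ _

@[simp]
theorem twistedMul_tmul (h : H) (a b : T) : twistedMul R T h (a ⊗ₜ b) = a * h • b := by
  simp [twistedMul]

/-- If `h` acts nontrivially modulo every maximal ideal, then the comparison map separates its
component at `h` from its component at `1`. -/
theorem exists_twistedMul_eq_zero (h : H)
    (hh : ∀ P : Ideal T, P.IsMaximal → h ∉ P.inertia H) :
    ∃ e : T ⊗[R] T, twistedMul R T (1 : H) e = 1 ∧ twistedMul R T h e = 0 := by
  have hsurj : Function.Surjective (twistedMul R T (1 : H)) := fun t ↦ ⟨t ⊗ₜ 1, by simp⟩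
  -- the values at `1` of the elements vanishing at `h` form an ideal that contains all `h b - b`
  let I : Ideal T := (RingHom.ker (twistedMul R T h)).map (twistedMul R T (1 : H))
  have hI : I = ⊤ := by
    by_contra hne
    obtain ⟨P, hP, hIP⟩ := Ideal.exists_le_maximal I hne
    refine hh P hP fun b ↦ hIP ?_
    have : twistedMul R T (1 : H) ((h • b) ⊗ₜ 1 - 1 ⊗ₜ b) = h • b - b := by simp
    rw [← this]
    refine Ideal.mem_map_of_mem _ ?_
    simp [RingHom.mem_ker]
  obtain ⟨e, he, he1⟩ := (Ideal.mem_map_iff_of_surjective _ hsurj).1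
    (show (1 : T) ∈ I by rw [hI]; trivial)
  exact ⟨e, he1, he⟩

/-- For a finite group without inertia there is an element of `T ⊗[R] T` which the comparison map
sends to the indicator function of `1`. -/
theorem exists_twistedMul_eq_ite [Fintype H] [DecidableEq H]
    (hH : ∀ P : Ideal T, P.IsMaximal → P.inertia H = ⊥) :
    ∃ e : T ⊗[R] T, ∀ h : H, twistedMul R T h e = if h = 1 then 1 else 0 := by
  have key : ∀ h : H, ∃ e : T ⊗[R] T, twistedMul R T (1 : H) e = 1 ∧
      (h ≠ 1 → twistedMul R T h e = 0) := by
    intro h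
    by_cases h1 : h = 1
    · exact ⟨1, map_one _, fun h2 ↦ absurd h1 h2⟩
    · obtain ⟨e, he, he'⟩ := exists_twistedMul_eq_zero (R := R) h fun P hP hmem ↦
        h1 (Subgroup.mem_bot.1 (hH P hP ▸ hmem))
      exact ⟨e, he, fun _ ↦ he'⟩
  choose e he he' using key
  refine ⟨∏ h, e h, fun h ↦ ?_⟩
  split_ifs with h1
  · subst h1
    simp [map_prod, he]
  · rw [map_prod]
    exact Finset.prod_eq_zero (Finset.mem_univ h) (he' h h1)

variable [Fintype H] [Algebra.IsInvariant R T H]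

/-- The trace map of a faithful invariant extension with finite group: `t` is sent to the unique
element of `R` with image `∑ h, h • t`. -/
noncomputable def groupTrace (R T H : Type*) [CommRing R] [CommRing T] [Algebra R T] [Group H]
    [MulSemiringAction H T] [SMulCommClass H R T] [Fintype H] [Algebra.IsInvariant R T H]
    (hinj : Function.Injective (algebraMap R T)) : T →ₗ[R] R where
  toFun t := (exists_algebraMap_eq_sum_smul (R := R) (H := H) t).choose
  map_add' a b := hinj <| by
    rw [map_add, (exists_algebraMap_eq_sum_smul (R := R) (H := H) (a + b)).choose_spec,
      (exists_algebraMap_eq_sum_smul (R := R) (H := H) a).choose_spec,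
      (exists_algebraMap_eq_sum_smul (R := R) (H := H) b).choose_spec]
    simp [Finset.sum_add_distrib]
  map_smul' r a := hinj <| by
    rw [(exists_algebraMap_eq_sum_smul (R := R) (H := H) (r • a)).choose_spec, smul_eq_mul,
      map_mul, RingHom.id_apply,
      (exists_algebraMap_eq_sum_smul (R := R) (H := H) a).choose_spec, ← Algebra.smul_def,
      Finset.smul_sum]
    exact Finset.sum_congr rfl fun h _ ↦ smul_comm h r a

theorem algebraMap_groupTrace (hinj : Function.Injective (algebraMap R T)) (t : T) :
    algebraMap R T (groupTrace R T H hinj t) = ∑ h : H, h • t :=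
  (exists_algebraMap_eq_sum_smul (R := R) (H := H) t).choose_spec

/-- An invariant extension with finite group and without inertia at the maximal ideals is strongly
separable. If `∑ x ⊗ y` is sent to the indicator function of `1`, then every `b` equals
`∑ tr(b x) y`; this makes `T` finite projective, and it makes the comparison map injective, so that
`∑ x ⊗ y` is a separability idempotent. -/
theorem isStronglySeparable_of_inertia_eq_bot (hinj : Function.Injective (algebraMap R T))
    (hH : ∀ P : Ideal T, P.IsMaximal → P.inertia H = ⊥) : IsStronglySeparable R T := by
  classical
  obtain ⟨e, he⟩ := exists_twistedMul_eq_ite (R := R) hH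
  obtain ⟨S, hS⟩ := TensorProduct.exists_finset e
  have hdual : ∀ b : T, b = ∑ i ∈ S, groupTrace R T H hinj (b * i.1) • i.2 := by
    intro b
    have h1 : ∀ h : H, ∑ i ∈ S, h • i.1 * i.2 = if h = 1 then 1 else 0 := by
      intro h
      have := congrArg (h • ·) (he h⁻¹)
      simp only [hS, map_sum, twistedMul_tmul, Finset.smul_sum, smul_mul', smul_inv_smul,
        inv_eq_one] at this
      rw [this]
      split_ifs <;> simp
    calc b = ∑ h : H, h • b * ∑ i ∈ S, h • i.1 * i.2 := by simp [h1]
      _ = ∑ i ∈ S, groupTrace R T H hinj (b * i.1) • i.2 := by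
        simp_rw [Finset.mul_sum]
        rw [Finset.sum_comm]
        refine Finset.sum_congr rfl fun i _ ↦ ?_
        rw [Algebra.smul_def, algebraMap_groupTrace, Finset.sum_mul]
        exact Finset.sum_congr rfl fun h _ ↦ by rw [smul_mul', mul_assoc]
  let coord : T →ₗ[R] (S → R) :=
    LinearMap.pi fun i ↦ groupTrace R T H hinj ∘ₗ LinearMap.mulRight R i.1.1
  let comb : (S → R) →ₗ[R] T := Fintype.linearCombination R fun i : S ↦ i.1.2
  have hsplit : ∀ b, comb (coord b) = b := by
    intro b
    conv_rhs => rw [hdual b]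
    simp only [comb, coord, Fintype.linearCombination_apply]
    exact Finset.sum_coe_sort S fun i ↦ groupTrace R T H hinj (b * i.1) • i.2
  have hexp : ∀ z : T ⊗[R] T,
      z = ∑ h : H, (twistedMul R T h z ⊗ₜ 1) * ∑ i ∈ S, (h • i.1) ⊗ₜ[R] i.2 := by
    intro z
    induction z with
    | zero => simp
    | add z w hz hw =>
      simp only [map_add, TensorProduct.add_tmul, add_mul, Finset.sum_add_distrib]
      rw [← hz, ← hw]
    | tmul a b =>
      conv_lhs => rw [hdual b]
      simp_rw [Finset.mul_sum]
      rw [Finset.sum_comm, TensorProduct.tmul_sum]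
      refine Finset.sum_congr rfl fun i _ ↦ ?_
      rw [← TensorProduct.smul_tmul, Algebra.smul_def, algebraMap_groupTrace, Finset.sum_mul,
        TensorProduct.sum_tmul]
      refine Finset.sum_congr rfl fun h _ ↦ ?_
      simp only [twistedMul_tmul, Algebra.TensorProduct.tmul_mul_tmul, one_mul, smul_mul']
      congr 1
      ring
  have hcentral : ∀ t : T, (1 ⊗ₜ t) * e = (t ⊗ₜ 1) * e := by
    intro t
    rw [← sub_eq_zero, ← sub_mul, hexp ((1 ⊗ₜ t - t ⊗ₜ 1) * e)]
    refine Finset.sum_eq_zero fun h _ ↦ ?_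
    rw [map_mul, he]
    split_ifs with h1
    · simp [h1]
    · simp
  have hone : Algebra.TensorProduct.lmul' R (S := T) e = 1 := by
    have : twistedMul R T (1 : H) = Algebra.TensorProduct.lmul' R (S := T) := by
      ext <;> simp
    rw [← this, he, if_pos rfl]
  refine ⟨?_, Module.Finite.of_surjective comb fun b ↦ ⟨_, hsplit b⟩,
    Module.Projective.of_split coord comb (LinearMap.ext hsplit)⟩
  let : Module (T ⊗[R] T) T :=
    Module.compHom T (Algebra.TensorProduct.lmul' R (S := T)).toRingHom
  have hsmul : ∀ (z : T ⊗[R] T) (t : T), z • t = Algebra.TensorProduct.lmul' R (S := T) z * t :=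
    fun _ _ ↦ rfl
  have hlift : ∀ z : T ⊗[R] T,
      (Algebra.TensorProduct.lmul' R (S := T) z ⊗ₜ[R] (1 : T)) * e = z * e := by
    intro z
    induction z with
    | zero => simp
    | add z w hz hw => rw [map_add, TensorProduct.add_tmul, add_mul, hz, hw, add_mul]
    | tmul a b =>
      rw [Algebra.TensorProduct.lmul'_apply_tmul]
      have h1 : (a * b) ⊗ₜ[R] (1 : T) = (a ⊗ₜ 1) * (b ⊗ₜ 1) := by simp
      have h2 : a ⊗ₜ[R] b = (a ⊗ₜ 1) * (1 ⊗ₜ b) := by simp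
      rw [h1, h2, mul_assoc, mul_assoc, hcentral]
  let i : T →ₗ[T ⊗[R] T] T ⊗[R] T :=
    { toFun := fun t ↦ (t ⊗ₜ 1) * e
      map_add' := fun a b ↦ by rw [TensorProduct.add_tmul, add_mul]
      map_smul' := fun z t ↦ by
        have h1 : (Algebra.TensorProduct.lmul' R (S := T) z * t) ⊗ₜ[R] (1 : T) =
            (t ⊗ₜ 1) * (Algebra.TensorProduct.lmul' R (S := T) z ⊗ₜ 1) := by simp [mul_comm]
        rw [hsmul, h1, mul_assoc, hlift, RingHom.id_apply, smul_eq_mul]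
        ring }
  let s : T ⊗[R] T →ₗ[T ⊗[R] T] T :=
    { toFun := Algebra.TensorProduct.lmul' R (S := T)
      map_add' := map_add _
      map_smul' := fun z w ↦ by rw [smul_eq_mul, map_mul, hsmul, RingHom.id_apply] }
  exact Module.Projective.of_split i s (LinearMap.ext fun t ↦ by
    change Algebra.TensorProduct.lmul' R (S := T) ((t ⊗ₜ 1) * e) = t
    rw [map_mul, hone, Algebra.TensorProduct.lmul'_apply_tmul, mul_one, mul_one])

end FiniteGroup

/-! ### Profinite groups acting without inertia -/

section ProfiniteGroup

open scoped Pointwise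

variable {A B : Type*} [CommRing A] [CommRing B] [Algebra A B]
variable {G : Type*} [Group G] [MulSemiringAction G B] [SMulCommClass G A B]
variable [TopologicalSpace G] [CompactSpace G] [TotallyDisconnectedSpace G]
variable [IsTopologicalGroup G] [TopologicalSpace B] [DiscreteTopology B] [ContinuousSMul G B]

/-- A form of the surjectivity of the decomposition group onto the residual automorphisms: a ring
automorphism that stabilizes `Q` and is the identity on `A` modulo `Q` is given modulo `Q` by an
element of the group. -/
theorem exists_smul_sub_mem (A : Type*) [CommRing A] [Algebra A B] [SMulCommClass G A B]
    [Algebra.IsInvariant A B G] (Q : Ideal B) [Q.IsPrime] (φ : B ≃+* B)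
    (hQ : Q = Q.map (φ : B →+* B))
    (hφ : ∀ a : A, φ (algebraMap A B a) - algebraMap A B a ∈ Q) :
    ∃ g : G, ∀ x : B, g • x - φ x ∈ Q := by
  let σ : (B ⧸ Q) ≃ₐ[A ⧸ Q.under A] (B ⧸ Q) :=
    AlgEquiv.ofRingEquiv (f := Ideal.quotientEquiv Q Q φ hQ) fun a ↦ by
      obtain ⟨a, rfl⟩ := Ideal.Quotient.mk_surjective a
      exact Ideal.Quotient.eq.2 (hφ a)
  obtain ⟨g, hg⟩ := Ideal.Quotient.stabilizerHom_surjective_of_profinite (G := G) (Q.under A) Q σ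
  refine ⟨g.1, fun x ↦ Ideal.Quotient.eq.1 ?_⟩
  exact DFunLike.congr_fun hg (Ideal.Quotient.mk Q x)

/-- If `B` is a domain, every automorphism of `B` over its invariants comes from the group. -/
theorem exists_smul_eq_algEquiv [Algebra.IsInvariant A B G] [IsDomain B] (f : B ≃ₐ[A] B) :
    ∃ g : G, ∀ x : B, g • x = f x := by
  obtain ⟨g, hg⟩ := exists_smul_sub_mem (G := G) A (⊥ : Ideal B) f.toRingEquiv
    (Ideal.map_bot).symm (fun a ↦ by simp)
  exact ⟨g, fun x ↦ sub_eq_zero.1 (hg x)⟩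

/-- Absence of inertia passes to the quotient by an open normal subgroup. An element that acts
trivially modulo a prime `P` of the fixed ring of `N` can be moved by `N` into the stabilizer of a
prime `Q` above `P`, and then by the decomposition group of `Q` in `N` into the inertia group of
`Q`. -/
theorem inertia_quotient_eq_bot [Algebra.IsInvariant A B G]
    (hB : ∀ Q : Ideal B, Q.IsPrime → Q.inertia G = ⊥) (N : OpenNormalSubgroup G)
    (P : Ideal (FixedPoints.subalgebra A B N.1.1)) [P.IsPrime] :
    P.inertia (G ⧸ N.1.1) = ⊥ := by
  let T := FixedPoints.subalgebra A B N.1.1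
  have : CompactSpace N.1.1 := isCompact_iff_compactSpace.1 N.1.isClosed.isCompact
  have : Algebra.IsInvariant T B N.1.1 := ⟨fun b hb ↦ ⟨⟨b, hb⟩, rfl⟩⟩
  have : Algebra.IsIntegral T B := Algebra.IsInvariant.isIntegral_of_profinite (G := N.1.1)
  rw [eq_bot_iff]
  intro h hh
  obtain ⟨g, rfl⟩ := QuotientGroup.mk_surjective h
  have hg : ∀ x : T, ∃ y ∈ P, (y : B) = g • (x : B) - x := fun x ↦
    ⟨(g : G ⧸ N.1.1) • x - x, hh x, rfl⟩
  obtain ⟨Q, -, hQ, hQP⟩ := Ideal.exists_ideal_over_prime_of_isIntegral P (⊥ : Ideal B) (by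
    intro x hx
    have : x = 0 := Subtype.ext (by simpa using hx)
    simp [this])
  have hgx : ∀ x : T, g • (x : B) - x ∈ Q := by
    intro x
    obtain ⟨y, hy, hyx⟩ := hg x
    rw [← hyx]
    rw [← hQP] at hy
    exact hy
  have hunder : (g • Q).under T = Q.under T := by
    ext x
    obtain ⟨y, hy⟩ : ∃ y : T, (y : B) = g⁻¹ • (x : B) := ⟨((g⁻¹ : G) : G ⧸ N.1.1) • x, rfl⟩
    have hxy : (x : B) - g⁻¹ • (x : B) ∈ Q := by simpa [hy] using hgx y
    change (x : B) ∈ g • Q ↔ (x : B) ∈ Q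
    rw [Ideal.mem_pointwise_smul_iff_inv_smul_mem]
    exact ⟨fun h ↦ by simpa using Q.add_mem hxy h, fun h ↦ by simpa using Q.sub_mem h hxy⟩
  obtain ⟨n, hn⟩ := Algebra.IsInvariant.exists_smul_of_under_eq_of_profinite (A := T)
    (G := N.1.1) (g • Q) Q hunder
  have hstab : Q = ((n : G) * g) • Q := by rw [mul_smul]; exact hn
  obtain ⟨m, hm⟩ := exists_smul_sub_mem (G := N.1.1) T Q
    (MulSemiringAction.toRingEquiv G B ((n : G) * g)) hstab (by
      intro x
      obtain ⟨y, hy⟩ : ∃ y : T, (y : B) = g • (x : B) := ⟨(g : G ⧸ N.1.1) • x, rfl⟩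
      have hny : (n : G) • (y : B) = y := y.2 n
      change ((n : G) * g) • (x : B) - x ∈ Q
      rw [mul_smul, ← hy, hny, hy]
      exact hgx x)
  have hmem : n * g * (m : G)⁻¹ ∈ Q.inertia G := by
    intro x
    have := Q.neg_mem (hm (m⁻¹ • x))
    rw [smul_inv_smul, neg_sub] at this
    rw [mul_smul]
    exact this
  rw [hB Q hQ, Subgroup.mem_bot] at hmem
  rw [Subgroup.mem_bot, QuotientGroup.eq_one_iff]
  have : g = (n : G)⁻¹ * m := by
    rw [mul_inv_eq_one] at hmem
    rw [← hmem, inv_mul_cancel_left]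
  rw [this]
  exact mul_mem (inv_mem n.2) m.2

/-- Over the invariants of a profinite group without inertia, every finite set of elements lies in
a strongly separable subalgebra, namely in the fixed ring of an open normal subgroup. -/
theorem exists_isStronglySeparable_subalgebra [Algebra.IsInvariant A B G]
    (hinj : Function.Injective (algebraMap A B))
    (hB : ∀ Q : Ideal B, Q.IsPrime → Q.inertia G = ⊥) (F : Finset B) :
    ∃ T : Subalgebra A B, (F : Set B) ⊆ T ∧ IsStronglySeparable A T := by
  have hopen : IsOpen (⋂ x ∈ F, (MulAction.stabilizer G x : Set G)) :=
    isOpen_biInter_finset fun x _ ↦ stabilizer_isOpen G x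
  obtain ⟨N, hN⟩ := ProfiniteGrp.exist_openNormalSubgroup_sub_open_nhds_of_one hopen
    (by simp)
  have : Finite (G ⧸ N.1.1) := inferInstance
  have := Fintype.ofFinite (G ⧸ N.1.1)
  refine ⟨FixedPoints.subalgebra A B N.1.1, fun x hx g ↦ ?_, ?_⟩
  · exact Set.mem_iInter₂.1 (hN g.2) x hx
  · refine isStronglySeparable_of_inertia_eq_bot (H := G ⧸ N.1.1) (fun a b hab ↦ hinj ?_)
      fun P hP ↦ inertia_quotient_eq_bot hB N P
    exact congrArg Subtype.val hab

end ProfiniteGroup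

/-! ### The profinite topology -/

section Topology

variable (k : Type*) [Field k]

/-- The discrete topology on the symmetric group. -/
local instance permTopology (n : ℕ) : TopologicalSpace (Equiv.Perm (Fin n)) := ⊥

local instance permDiscrete (n : ℕ) : DiscreteTopology (Equiv.Perm (Fin n)) := ⟨rfl⟩

theorem isEmbedding_left_right (n : ℕ) :
    Topology.IsEmbedding fun g : SigmaGam k n ↦ (g.left, g.right) where
  eq_induced := by
    simp only [instTopologicalSpaceProd, induced_inf, induced_compose]
    rfl
  injective := fun g h hgh ↦ SemidirectProduct.ext (congrArg Prod.fst hgh) (congrArg Prod.snd hgh)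

instance compactSpace_ZHat : CompactSpace (ZHat k) := by
  have : ∀ s : {s : ℕ // (s : k) ≠ 0}, NeZero s.1 := fun s ↦ ⟨fun h0 ↦ s.2 (by simp [h0])⟩
  refine isCompact_iff_compactSpace.1 (IsClosed.isCompact ?_)
  have hset : (ZHat k : Set (∀ s : {s : ℕ // (s : k) ≠ 0}, ZMod s.1)) =
      ⋂ (s) (t) (h : s.1 ∣ t.1), {x | ZMod.castHom h (ZMod s.1) (x t) = x s} := by
    ext x
    simp only [Set.mem_iInter]
    rfl
  rw [hset]
  refine isClosed_iInter fun s ↦ isClosed_iInter fun t ↦ isClosed_iInter fun h ↦ ?_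
  exact isClosed_eq (continuous_of_discreteTopology.comp (continuous_apply t)) (continuous_apply s)

instance totallyDisconnectedSpace_multiplicative_ZHat :
    TotallyDisconnectedSpace (Multiplicative (ZHat k)) :=
  inferInstanceAs (TotallyDisconnectedSpace (ZHat k))

instance compactSpace_sigmaGam (n : ℕ) : CompactSpace (SigmaGam k n) := by
  have hsurj : Function.Surjective fun g : SigmaGam k n ↦ (g.left, g.right) :=
    fun p ↦ ⟨⟨p.1, p.2⟩, rfl⟩
  exact ((isEmbedding_left_right k n).toHomeomorphOfSurjective hsurj).symm.compactSpace

instance totallyDisconnectedSpace_sigmaGam (n : ℕ) : TotallyDisconnectedSpace (SigmaGam k n) :=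
  ⟨(isEmbedding_left_right k n).isTotallyDisconnected
    (isTotallyDisconnected_of_totallyDisconnectedSpace _)⟩

instance isTopologicalGroup_sigmaGam (n : ℕ) : IsTopologicalGroup (SigmaGam k n) := by
  have hl : Continuous fun g : SigmaGam k n ↦ g.left :=
    continuous_fst.comp (isEmbedding_left_right k n).continuous
  have hr : Continuous fun g : SigmaGam k n ↦ g.right :=
    continuous_snd.comp (isEmbedding_left_right k n).continuous
  -- the permutation action is continuous because the permutation group is discrete
  have hact : Continuous fun p : Gam k n × Equiv.Perm (Fin n) ↦
      (mulAutArrow p.2 p.1 : Gam k n) := by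
    rw [continuous_prod_of_discrete_right]
    exact fun σ ↦ continuous_pi fun i ↦ continuous_apply (σ⁻¹ i)
  refine { continuous_mul := ?_, continuous_inv := ?_ }
  · refine (isEmbedding_left_right k n).continuous_iff.2 (Continuous.prodMk ?_ ?_)
    · exact (hl.comp continuous_fst).mul
        (hact.comp ((hl.comp continuous_snd).prodMk (hr.comp continuous_fst)))
    · exact (continuous_of_discreteTopology
        (f := fun p : Equiv.Perm (Fin n) × Equiv.Perm (Fin n) ↦ p.1 * p.2)).comp
          ((hr.comp continuous_fst).prodMk (hr.comp continuous_snd))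
  · refine (isEmbedding_left_right k n).continuous_iff.2 (Continuous.prodMk ?_ ?_)
    · exact hact.comp (hl.inv.prodMk ((continuous_of_discreteTopology
        (f := fun σ : Equiv.Perm (Fin n) ↦ σ⁻¹)).comp hr))
    · exact (continuous_of_discreteTopology
        (f := fun σ : Equiv.Perm (Fin n) ↦ σ⁻¹)).comp hr

end Topology

/-! ### The action on the ring of fractional Laurent polynomials -/

section Action

variable {k : Type*} [Field k] (θ : (Expo k ⧸ intExpo k) ≃+ Additive (MuInf k)) {n : ℕ}

theorem act_single (g : SigmaGam k n) (a : Fin n → Expo k) (c : k) :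
    act θ n g (AddMonoidAlgebra.single a c) = AddMonoidAlgebra.single (fun i ↦ a (g.right⁻¹ i))
      (c * scalar θ g.left (fun i ↦ a (g.right⁻¹ i))) := by
  change AddMonoidAlgebra.lift k (EE k n) (Fin n → Expo k) (monoAct θ g) _ = _
  rw [AddMonoidAlgebra.lift_single]
  simp [monoAct]

/-- The action of a subgroup of `Σ_n ⋉ Γ_n` on `𝔼_n`. -/
noncomputable abbrev mulSemiringActionEE (G : Subgroup (SigmaGam k n)) : MulSemiringAction G (EE k n) :=
  MulSemiringAction.compHom (EE k n) ((act θ n).comp G.subtype)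

theorem chi_eq_one_of_coord_eq_zero (x : ZHat k) (q : Expo k) (h : x.1 ⟨q.1.den, q.2⟩ = 0) :
    chi θ x q = 1 := by
  have : NeZero q.1.den := ⟨q.1.den_nz⟩
  simp [chi, pair, h]

/-- An element of the limit that acts trivially on all roots of the variable is zero: its action on
the `s`-th root determines its residue modulo `s`. -/
theorem eq_zero_of_chi_eq_one (x : ZHat k) (h : ∀ q, chi θ x q = 1) : x = 0 := by
  refine Subtype.ext (funext fun s ↦ ?_)
  have hs : s.1 ≠ 0 := fun h0 ↦ s.2 (by simp [h0])
  have : NeZero s.1 := ⟨hs⟩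
  have hden : ((s.1 : ℚ)⁻¹).den = s.1 := by
    simp [hs]
  let q : Expo k := ⟨(s.1 : ℚ)⁻¹, by simpa [Expo, hden] using s.2⟩
  have h1 : pair x q = 0 := by simpa [chi] using h q
  rw [pair_eq x q s (by simp [q, hden]), ← QuotientAddGroup.mk_nsmul,
    QuotientAddGroup.eq_zero_iff, intExpo, AddSubgroup.mem_zmultiples_iff] at h1
  obtain ⟨z, hz⟩ := h1
  have hz' : (z : ℚ) = (x.1 s).val * (s.1 : ℚ)⁻¹ := by
    simpa [q] using congrArg Subtype.val hz
  have hz2 : z * s.1 = (x.1 s).val := by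
    have : (s.1 : ℚ) ≠ 0 := by exact_mod_cast hs
    field_simp at hz'
    exact_mod_cast hz'
  have hdvd : s.1 ∣ (x.1 s).val := by
    exact_mod_cast (Dvd.intro_left z hz2 : (s.1 : ℤ) ∣ ((x.1 s).val : ℤ))
  have := Nat.eq_zero_of_dvd_of_lt hdvd (ZMod.val_lt _)
  exact (ZMod.val_eq_zero _).1 this

theorem eq_one_of_scalar_eq_one (x : Gam k n) (h : ∀ a, scalar θ x a = 1) : x = 1 := by
  funext i
  refine Multiplicative.toAdd.injective (eq_zero_of_chi_eq_one θ _ fun q ↦ ?_)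
  have := h (Pi.single i q)
  rw [scalar, Finset.prod_eq_single i (fun j _ hj ↦ by simp [hj, chi_zero_right]) (by simp)] at this
  simpa using this

theorem act_pow_sub_mem (Q : Ideal (EE k n)) (g : SigmaGam k n)
    (hg : ∀ x, act θ n g x - x ∈ Q) (d : ℕ) (x : EE k n) : act θ n (g ^ d) x - x ∈ Q := by
  induction d generalizing x with
  | zero => simp
  | succ d ih =>
    rw [pow_succ, map_mul, AlgEquiv.mul_apply]
    simpa using Q.add_mem (ih (act θ n g x)) (hg x)

/-- An element of `Σ_n ⋉ Γ_n` that acts trivially modulo a proper ideal has finite order: a power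
of it lies in `Γ_n` and multiplies the monomials, which are units, by constants; these constants
are `1` modulo the ideal, hence `1`. -/
theorem isOfFinOrder_of_act_sub_mem (Q : Ideal (EE k n)) (hQ : Q ≠ ⊤) (g : SigmaGam k n)
    (hg : ∀ x, act θ n g x - x ∈ Q) : IsOfFinOrder g := by
  refine isOfFinOrder_iff_pow_eq_one.2 ⟨orderOf g.right, orderOf_pos _, ?_⟩
  have hright : (g ^ orderOf g.right).right = 1 := by
    have : (g ^ orderOf g.right).right = g.right ^ orderOf g.right :=
      map_pow (SemidirectProduct.rightHom (φ := mulAutArrow)) g _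
    rw [this, pow_orderOf_eq_one]
  refine SemidirectProduct.ext (eq_one_of_scalar_eq_one θ _ fun a ↦ ?_) hright
  by_contra hne
  have h := act_pow_sub_mem θ Q g hg (orderOf g.right) (AddMonoidAlgebra.single a 1)
  rw [act_single, hright, one_mul] at h
  simp only [inv_one, Equiv.Perm.coe_one, id_eq] at h
  rw [← AddMonoidAlgebra.single_sub] at h
  refine hQ ((Ideal.eq_top_iff_one _).2 ?_)
  have h2 := Q.mul_mem_left (AddMonoidAlgebra.single (-a)
    (scalar θ (g ^ orderOf g.right).left a - 1)⁻¹) h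
  rw [AddMonoidAlgebra.single_mul_single, neg_add_cancel, inv_mul_cancel₀ (sub_ne_zero.2 hne)] at h2
  exact h2

/-- The stabilizer of `f` is open: it contains all elements of `Γ_n` whose coordinates vanish modulo
the denominators of the exponents occurring in `f`. -/
theorem isOpen_stabilizer_act (f : EE k n) : IsOpen {g : SigmaGam k n | act θ n g f = f} := by
  let K : Subgroup (SigmaGam k n) :=
    (MulAction.stabilizer (EE k n ≃ₐ[k] EE k n) f).comap (act θ n)
  change IsOpen (K : Set (SigmaGam k n))
  suffices h : ∃ U : Set (SigmaGam k n), IsOpen U ∧ 1 ∈ U ∧ U ⊆ K by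
    obtain ⟨U, hU, h1, hUK⟩ := h
    exact K.isOpen_of_mem_nhds (Filter.mem_of_superset (hU.mem_nhds h1) hUK)
  induction f using AddMonoidAlgebra.induction_linear with
  | zero => exact ⟨Set.univ, isOpen_univ, trivial, fun g _ ↦ map_zero (act θ n g)⟩
  | add f₁ f₂ h₁ h₂ =>
    obtain ⟨U, hU, h1, hUK⟩ := h₁
    obtain ⟨V, hV, h2, hVK⟩ := h₂
    refine ⟨U ∩ V, hU.inter hV, ⟨h1, h2⟩, fun g hg ↦ ?_⟩
    have e1 : act θ n g f₁ = f₁ := hUK hg.1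
    have e2 : act θ n g f₂ = f₂ := hVK hg.2
    change act θ n g (f₁ + f₂) = f₁ + f₂
    rw [map_add, e1, e2]
  | single a c =>
    refine ⟨(fun g ↦ g.right) ⁻¹' {1} ∩
      ⋂ i, (fun g ↦ (g.left i).toAdd.1 ⟨(a i).1.den, (a i).2⟩) ⁻¹' {0}, ?_, ?_, ?_⟩
    · have hr : IsOpen ((fun g : SigmaGam k n ↦ g.right) ⁻¹' {1}) :=
        (inf_le_right : sigmaGamTopology k n ≤ _) _ ⟨{1}, trivial, rfl⟩
      have hl : Continuous fun g : SigmaGam k n ↦ g.left :=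
        continuous_iff_le_induced.2 inf_le_left
      refine IsOpen.inter hr (isOpen_iInter_of_finite fun i ↦ ?_)
      refine (isOpen_discrete _).preimage ?_
      exact (continuous_apply _).comp (continuous_subtype_val.comp
        (continuous_toAdd.comp ((continuous_apply i).comp hl)))
    · refine ⟨rfl, Set.mem_iInter.2 fun i ↦ rfl⟩
    · rintro g ⟨hr, hl⟩
      have hr : g.right = 1 := hr
      have hl : ∀ i, (g.left i).toAdd.1 ⟨(a i).1.den, (a i).2⟩ = 0 := Set.mem_iInter.1 hl
      change act θ n g _ = _
      rw [act_single, hr]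
      simp [scalar, chi_eq_one_of_coord_eq_zero θ _ _ (hl _)]

end Action

end TorusGalois

open TorusGalois in
theorem mainTheorem5 (k : Type*) [Field k]
    (hk : ∀ m : ℕ, 0 < m → (Polynomial.X ^ m - 1 : Polynomial k).Splits)
    (θ : (TorusGalois.Expo k ⧸ TorusGalois.intExpo k) ≃+ Additive (TorusGalois.MuInf k))
    (n : ℕ) (G : Subgroup (TorusGalois.SigmaGam k n))
    (hclosed : IsClosed (G : Set (TorusGalois.SigmaGam k n)))
    (htf : ∀ g ∈ G, IsOfFinOrder g → g = 1) :
    TorusGalois.IsGaloisExtension (TorusGalois.fixedRing θ G) (TorusGalois.EE k n) ∧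
      Function.Bijective (TorusGalois.galoisHom θ G) := by
  let := mulSemiringActionEE θ G
  let : TopologicalSpace (EE k n) := ⊥
  have : DiscreteTopology (EE k n) := ⟨rfl⟩
  have : CompactSpace G := isCompact_iff_compactSpace.1 hclosed.isCompact
  have : ContinuousSMul G (EE k n) := continuousSMul_iff_stabilizer_isOpen.2 fun f ↦
    (isOpen_stabilizer_act θ f).preimage continuous_subtype_val
  have : SMulCommClass G (fixedRing θ G) (EE k n) := ⟨fun g r x ↦ by
    change act θ n g (r.1 * x) = r.1 * act θ n g x
    rw [map_mul, r.2 g g.2]⟩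
  have : Algebra.IsInvariant (fixedRing θ G) (EE k n) G :=
    ⟨fun b hb ↦ ⟨⟨b, fun g hg ↦ hb ⟨g, hg⟩⟩, rfl⟩⟩
  have hinertia : ∀ Q : Ideal (EE k n), Q.IsPrime → Q.inertia G = ⊥ := fun Q hQ ↦
    (eq_bot_iff).2 fun g hg ↦ Subgroup.mem_bot.2 <| Subtype.ext <| htf g g.2 <|
      isOfFinOrder_of_act_sub_mem θ Q hQ.ne_top g hg
  -- the exponent group is torsion free, so its group algebra has no zero divisors
  have hdom : IsDomain (EE k n) := inferInstance
  refine ⟨⟨Subtype.val_injective, inferInstance, fun e he ↦ ?_,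
    exists_isStronglySeparable_subalgebra Subtype.val_injective hinertia, fun x hx ↦ ?_⟩, ?_, ?_⟩
  · exact (IsIdempotentElem.iff_eq_zero_or_one).1 he
  · exact ⟨⟨x, fun g hg ↦ hx (galoisHom θ G ⟨g, hg⟩)⟩, rfl⟩
  · refine (injective_iff_map_eq_one _).2 fun g hg ↦ ?_
    have h : g ∈ (⊥ : Ideal (EE k n)).inertia G := fun x ↦
      sub_eq_zero.2 (DFunLike.congr_fun hg x)
    rwa [hinertia ⊥ Ideal.isPrime_bot, Subgroup.mem_bot] at h
  · intro f
    obtain ⟨g, hg⟩ := exists_smul_eq_algEquiv (G := G) f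
    exact ⟨g, AlgEquiv.ext hg⟩
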